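/- Let $G=(V,E)$ be a finite simple undirected graph. With variables $\mathbf{x}=(x_v)_{v\in V}$ and $\mathbf{w}=(w_e)_{e\in E}$, let $$\mu(G,\mathbf{x}\oplus\mathbf{w})=\sum_{M}(-1)^{|M|}\prod_{v\notin V(M)}x_v\prod_{e\in M}w_e^2\in\mathbb{R}[\mathbf{x},\mathbf{w}],$$ where $M$ runs over all matchings of $G$ (sets of edges, including the empty set, no two of which share a vertex) and $V(M)$ is the set of vertices covered by $M$. A homogeneous polynomial $h\in\mathbb{R}[z_1,\dots,z_n]$ is hyperbolic with respect to $\mathbf{e}\in\mathbb{R}^n$ if $h(\mathbf{e})\neq0$ and, for every $\mathbf{z}\in\mathbb{R}^n$, all complex zeros of the univariate polynomial $t\mapsto h(t\mathbf{e}-\mathbf{z})$ are real; its hyperbolicity cone $\Lambda_+(h,\mathbf{e})$ is then the set of all $\mathbf{z}\in\mathbb{R}^n$ for which all zeros of $t\mapsto h(t\mathbf{e}-\mathbf{z})$ are nonnegative. A cone in $\mathbb{R}^n$ is spectrahedral if it is of the form $$\Big\{\mathbf{z}\in\mathbb{R}^n:\ \sum_{i=1}^n z_iA_i\ \text{is positive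 semidefinite}\Big\}$$ for real symmetric matrices $A_1,\dots,A_n$ of the same size such that $\sum_{i=1}^n y_iA_i$ is positive definite for some $\mathbf{y}\in\mathbb{R}^n$. **Theorem.** The polynomial $\mu(G,\mathbf{x}\oplus\mathbf{w})$ is hyperbolic with respect to $\mathbf{1}\oplus\mathbf{0}$ (all vertex coordinates equal to $1$, all edge coordinates equal to $0$), and its hyperbolicity cone $\Lambda_+(\mu(G,\mathbf{x}\oplus\mathbf{w}),\mathbf{1}\oplus\mathbf{0})\subseteq\mathbb{R}^V\times\mathbb{R}^E$ is spectrahedral. -/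

import Mathlib

/-- A homogeneous real polynomial `h` is hyperbolic with respect to `e` if `h(e) ≠ 0` and, for
every real vector `x`, all complex zeros of the univariate polynomial `t ↦ h(t e - x)` are real. -/
def IsHyperbolic {ι : Type*} (h : MvPolynomial ι ℝ) (e : ι → ℝ) : Prop :=
  (∃ d : ℕ, h.IsHomogeneous d) ∧ MvPolynomial.eval e h ≠ 0 ∧
    ∀ (x : ι → ℝ) (z : ℂ),
      MvPolynomial.aeval (fun i => z * (e i : ℂ) - (x i : ℂ)) h = 0 → z.im = 0

/-- The (closed) hyperbolicity cone of `h` with respect to `e`: the vectors `x` all of whose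
eigenvalues, i.e. the zeros of `t ↦ h(t e - x)`, are nonnegative. -/
def hyperbolicityCone {ι : Type*} (h : MvPolynomial ι ℝ) (e : ι → ℝ) : Set (ι → ℝ) :=
  {x | ∀ t : ℝ, MvPolynomial.eval (t • e - x) h = 0 → 0 ≤ t}

/-- A set of the form `{x : ∑ xᵢ Aᵢ is positive semidefinite}` for real symmetric matrices `Aᵢ` of
the same size, some linear combination of which is positive definite. -/
def IsSpectrahedral {ι : Type*} [Fintype ι] (K : Set (ι → ℝ)) : Prop :=
  ∃ (m : ℕ) (A : ι → Matrix (Fin m) (Fin m) ℝ),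
    (∀ i, (A i).IsSymm) ∧
    (∃ y : ι → ℝ, (∑ i, y i • A i).PosDef) ∧
    K = {x | (∑ i, x i • A i).PosSemidef}

/-- A set of edges of `G`, no two of which have a vertex in common. -/
def IsEdgeMatching {V : Type*} {G : SimpleGraph V} (M : Finset G.edgeSet) : Prop :=
  ∀ e ∈ M, ∀ f ∈ M, e ≠ f → ∀ v : V, ¬ (v ∈ (e : Sym2 V) ∧ v ∈ (f : Sym2 V))

open Classical in
/-- The homogeneous multivariate matching polynomial `μ(G, x ⊕ w)`, in the vertex variables
`x v = X (Sum.inl v)` and the edge variables `w e = X (Sum.inr e)`. -/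
noncomputable def matchingPolynomial {V : Type*} [Fintype V] (G : SimpleGraph V)
    [Fintype G.edgeSet] : MvPolynomial (V ⊕ G.edgeSet) ℝ :=
  ∑ M : Finset G.edgeSet with IsEdgeMatching M,
    (-1) ^ M.card *
      (∏ v : V with ∀ e ∈ M, v ∉ (e : Sym2 V), MvPolynomial.X (Sum.inl v)) *
      ∏ e ∈ M, MvPolynomial.X (Sum.inr e) ^ 2

/-- The vector `1 ⊕ 0`: all vertex coordinates are `1`, all edge coordinates are `0`. -/
def vertexOnes {V : Type*} (G : SimpleGraph V) : V ⊕ G.edgeSet → ℝ :=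
  Sum.elim (fun _ => 1) (fun _ => 0)

/-! Write m(S) for the signed matching sum of the subgraph induced on S, with squared edge variables
as edge weights. Expanding at a vertex u gives m(S) = x_u m(S∖u) − ∑_v w_uv² m(S∖{u,v})
(`inducedMatchingSum_eq`), and everything rests on this recursion.

Hyperbolicity is the Heilmann–Lieb argument: when all x_v lie in the upper half-plane, so do the
ratios m(S)/m(S∖u), hence m(S) ≠ 0.

For the cone, unfold the recursion along a forest in the manner of Godsil's path tree. The nodes are
the nonempty lists of distinct vertices, with the tail as parent, and the pencil is the weighted
adjacency matrix of this forest. If all m(S) are positive, the ratios m(off tail l)/m(off l) are the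
pivots of an elimination from the leaves to the roots, which writes the quadratic form as a sum of
squares (`dotProduct_pathPencil_nonneg`). Conversely, a zero of some m(S) produces a nonzero vector
on which the form vanishes (`inducedMatchingSum_ne_zero_of_pathPencil`). Both are applied after
shifting by s > 0 along 1 ⊕ 0, which the pencil maps to the identity. A one-sided interlacing
argument (`inducedMatchingSum_erase_pos`) passes positivity from the whole vertex set to all S. -/

open Classical in
/-- The weighted matching sum of the subgraph of `G` induced on `S`, with vertex weights `x` and
edge weights `b`. -/
noncomputable def inducedMatchingSum {V R : Type*} [CommRing R] (G : SimpleGraph V)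
    [Fintype G.edgeSet] (x : V → R) (b : G.edgeSet → R) (S : Finset V) : R :=
  ∑ M : Finset G.edgeSet with IsEdgeMatching M ∧ ∀ e ∈ M, ∀ v ∈ (e : Sym2 V), v ∈ S,
    (-1) ^ M.card * (∏ v ∈ S with ∀ e ∈ M, v ∉ (e : Sym2 V), x v) * ∏ e ∈ M, b e

open Classical in
/-- The weight of the pair `u v`, which is zero for non-adjacent vertices. -/
noncomputable def adjWeight {V R : Type*} [Zero R] {G : SimpleGraph V} (b : G.edgeSet → R)
    (u v : V) : R :=
  if h : G.Adj u v then b ⟨s(u, v), h⟩ else 0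

/-! ### Vertex expansion of matching sums -/

section Recursion

variable {V R : Type*} {G : SimpleGraph V}

theorem adjWeight_comm [Zero R] (b : G.edgeSet → R) (u v : V) :
    adjWeight b u v = adjWeight b v u := by
  unfold adjWeight
  by_cases h : G.Adj u v
  · have h' := h.symm
    simp only [h, h', dif_pos]
    congr 2
    exact Sym2.eq_swap
  · have h' : ¬ G.Adj v u := fun h' => h h'.symm
    simp [h, h']

theorem adjWeight_map {R' : Type*} [Zero R] [Zero R'] (b : G.edgeSet → R) (f : R → R')
    (hf : f 0 = 0) (u v : V) : adjWeight (fun e => f (b e)) u v = f (adjWeight b u v) := by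
  unfold adjWeight
  split_ifs <;> simp [hf]

variable [Fintype G.edgeSet] [CommRing R]

theorem map_inducedMatchingSum {R' : Type*} [CommRing R'] (f : R →+* R') (x : V → R)
    (b : G.edgeSet → R) (S : Finset V) :
    f (inducedMatchingSum G x b S) =
      inducedMatchingSum G (fun v => f (x v)) (fun e => f (b e)) S := by
  simp [inducedMatchingSum, map_sum, map_mul, map_prod]

theorem inducedMatchingSum_empty (x : V → R) (b : G.edgeSet → R) :
    inducedMatchingSum G x b ∅ = 1 := by
  classical
  unfold inducedMatchingSum
  rw [Finset.sum_eq_single ∅]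
  · simp
  · intro M hM hne
    obtain ⟨e, he⟩ := Finset.nonempty_iff_ne_empty.2 hne
    simp only [Finset.mem_filter, Finset.mem_univ, true_and] at hM
    induction e using Subtype.rec with
    | _ e h =>
      induction e using Sym2.ind with
      | _ a c => exact absurd (hM.2 _ he a (Sym2.mem_mk_left a c)) (by simp)
  · intro h
    exact absurd (by simp [IsEdgeMatching]) h

open Classical in
/-- The summand of `inducedMatchingSum`. -/
noncomputable def matchingTerm (x : V → R) (b : G.edgeSet → R) (S : Finset V)
    (M : Finset G.edgeSet) : R :=
  (-1) ^ M.card * (∏ v ∈ S with ∀ e ∈ M, v ∉ (e : Sym2 V), x v) * ∏ e ∈ M, b e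

open Classical in
theorem sum_matchingTerm_uncovered (x : V → R) (b : G.edgeSet → R) {S : Finset V} {u : V}
    (hu : u ∈ S) :
    ∑ M : Finset G.edgeSet with (IsEdgeMatching M ∧ ∀ e ∈ M, ∀ v ∈ (e : Sym2 V), v ∈ S) ∧
        ∀ e ∈ M, u ∉ (e : Sym2 V), matchingTerm x b S M =
      x u * inducedMatchingSum G x b (S.erase u) := by
  unfold inducedMatchingSum
  rw [Finset.mul_sum]
  apply Finset.sum_congr
  · ext M
    simp only [Finset.mem_filter, Finset.mem_univ, true_and, Finset.mem_erase, and_assoc]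
    refine and_congr_right fun _ => ⟨fun h e he v hv => ⟨?_, h.1 e he v hv⟩,
      fun h => ⟨fun e he v hv => (h e he v hv).2, fun e he hue => (h e he u hue).1 rfl⟩⟩
    rintro rfl
    exact h.2 e he hv
  · intro M hM
    simp only [Finset.mem_filter, Finset.mem_univ, true_and, Finset.mem_erase] at hM
    have hN : ∀ e ∈ M, u ∉ (e : Sym2 V) := fun e he hue => (hM.2 e he u hue).1 rfl
    have : S.filter (fun v => ∀ e ∈ M, v ∉ (e : Sym2 V)) =
        insert u ((S.erase u).filter (fun v => ∀ e ∈ M, v ∉ (e : Sym2 V))) := by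
      rw [← Finset.insert_erase hu, Finset.filter_insert, if_pos hN, Finset.erase_insert (by simp)]
    rw [matchingTerm, this, Finset.prod_insert (by simp)]
    ring

-- Deleting the edge uv is a bijection onto the matchings that avoid both u and v; the lost edge
-- accounts for the sign.
open Classical in
theorem sum_matchingTerm_mem (x : V → R) (b : G.edgeSet → R) {S : Finset V} {u v : V}
    (hu : u ∈ S) (hv : v ∈ S.erase u) (h : G.Adj u v) :
    ∑ M : Finset G.edgeSet with (IsEdgeMatching M ∧ ∀ e ∈ M, ∀ v ∈ (e : Sym2 V), v ∈ S) ∧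
        (⟨s(u, v), h⟩ : G.edgeSet) ∈ M, matchingTerm x b S M =
      - (b ⟨s(u, v), h⟩ * inducedMatchingSum G x b ((S.erase u).erase v)) := by
  unfold inducedMatchingSum
  rw [Finset.mul_sum, ← Finset.sum_neg_distrib]
  set e₀ : G.edgeSet := ⟨s(u, v), h⟩ with he₀
  have hmem : ∀ a, a ∈ (e₀ : Sym2 V) ↔ a = u ∨ a = v := fun a => Sym2.mem_iff
  have hvS := Finset.mem_of_mem_erase hv
  have key : ∀ M : Finset G.edgeSet,
      (∀ e ∈ M, ∀ w ∈ (e : Sym2 V), w ∈ (S.erase u).erase v) → e₀ ∉ M := fun M hM h₀ => by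
    simpa using hM e₀ h₀ u ((hmem u).2 (Or.inl rfl))
  refine Finset.sum_bij' (fun M _ => M.erase e₀) (fun M _ => insert e₀ M) ?_ ?_ ?_ ?_ ?_
  · intro M hM
    simp only [Finset.mem_filter, Finset.mem_univ, true_and] at hM ⊢
    obtain ⟨⟨hm, hs⟩, h0⟩ := hM
    refine ⟨fun e he f hf => hm e (Finset.mem_of_mem_erase he) f (Finset.mem_of_mem_erase hf), ?_⟩
    intro e he w hw
    rw [Finset.mem_erase] at he
    have : ¬ (w = u ∨ w = v) := fun hc => hm e he.2 e₀ h0 he.1 w ⟨hw, (hmem w).2 hc⟩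
    push Not at this
    simp [this.1, this.2, hs e he.2 w hw]
  · intro M hM
    simp only [Finset.mem_filter, Finset.mem_univ, true_and] at hM ⊢
    obtain ⟨hm, hs⟩ := hM
    have hd : ∀ e ∈ M, ∀ w, ¬ (w ∈ (e : Sym2 V) ∧ w ∈ (e₀ : Sym2 V)) := by
      rintro e he w ⟨hw, hw'⟩
      have h1 := hs e he w hw
      rcases (hmem w).1 hw' with rfl | rfl <;> simp at h1
    refine ⟨⟨?_, ?_⟩, Finset.mem_insert_self _ _⟩
    · intro e he f hf hef w hw
      rcases Finset.mem_insert.1 he with rfl | he <;> rcases Finset.mem_insert.1 hf with rfl | hf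
      · exact hef rfl
      · exact hd f hf w hw.symm
      · exact hd e he w hw
      · exact hm e he f hf hef w hw
    · intro e he w hw
      rcases Finset.mem_insert.1 he with rfl | he
      · rcases (hmem w).1 hw with rfl | rfl <;> assumption
      · exact Finset.mem_of_mem_erase (Finset.mem_of_mem_erase (hs e he w hw))
  · intro M hM
    simp only [Finset.mem_filter] at hM
    exact Finset.insert_erase hM.2.2
  · intro M hM
    simp only [Finset.mem_filter] at hM
    exact Finset.erase_insert (key M hM.2.2)
  · intro M hM
    simp only [Finset.mem_filter, Finset.mem_univ, true_and] at hM
    obtain ⟨⟨hm, hs⟩, h0⟩ := hM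
    have hf : S.filter (fun v => ∀ e ∈ M, v ∉ (e : Sym2 V)) =
        ((S.erase u).erase v).filter (fun v => ∀ e ∈ M.erase e₀, v ∉ (e : Sym2 V)) := by
      ext w
      simp only [Finset.mem_filter, Finset.mem_erase]
      constructor
      · rintro ⟨hw, hM⟩
        have := hM e₀ h0
        rw [hmem] at this
        push Not at this
        exact ⟨⟨this.2, this.1, hw⟩, fun e he => hM e he.2⟩
      · rintro ⟨⟨h1, h2, h3⟩, hM⟩
        refine ⟨h3, fun e he => ?_⟩
        by_cases hee : e = e₀
        · rw [hee, hmem]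
          tauto
        · exact hM e ⟨hee, he⟩
    rw [matchingTerm, hf, ← Finset.mul_prod_erase M b h0, ← Finset.card_erase_add_one h0]
    ring

-- A matching either misses u or covers it by exactly one edge uv.
open Classical in
theorem inducedMatchingSum_eq (x : V → R) (b : G.edgeSet → R) {S : Finset V} {u : V}
    (hu : u ∈ S) :
    inducedMatchingSum G x b S = x u * inducedMatchingSum G x b (S.erase u) -
      ∑ v ∈ S.erase u, adjWeight b u v * inducedMatchingSum G x b ((S.erase u).erase v) := by
  -- For each matching exactly one of the indicators on the right is nonzero.
  have hsplit : inducedMatchingSum G x b S =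
      ∑ M : Finset G.edgeSet with (IsEdgeMatching M ∧ ∀ e ∈ M, ∀ v ∈ (e : Sym2 V), v ∈ S),
        ((if ∀ e ∈ M, u ∉ (e : Sym2 V) then matchingTerm x b S M else 0) +
        ∑ v ∈ S.erase u, if ∃ h : G.Adj u v, (⟨s(u, v), h⟩ : G.edgeSet) ∈ M then
          matchingTerm x b S M else 0) := by
    unfold inducedMatchingSum
    refine Finset.sum_congr rfl fun M hM => ?_
    simp only [Finset.mem_filter, Finset.mem_univ, true_and] at hM
    obtain ⟨hm, hs⟩ := hM
    change matchingTerm x b S M = _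
    by_cases hc : ∀ e ∈ M, u ∉ (e : Sym2 V)
    · rw [if_pos hc, Finset.sum_eq_zero, add_zero]
      intro v _
      rw [if_neg]
      rintro ⟨h, hM⟩
      exact hc _ hM (Sym2.mem_mk_left u v)
    · rw [if_neg hc, zero_add]
      push Not at hc
      obtain ⟨⟨e, heG⟩, heM, hue⟩ := hc
      obtain ⟨v, rfl⟩ := Sym2.mem_iff_exists.1 hue
      have hadj : G.Adj u v := heG
      rw [Finset.sum_eq_single v, if_pos ⟨hadj, heM⟩]
      · intro v' _ hne
        rw [if_neg]
        rintro ⟨h', hM'⟩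
        refine hm _ heM _ hM' ?_ u ⟨Sym2.mem_mk_left u v, Sym2.mem_mk_left u v'⟩
        intro heq
        exact hne (Sym2.congr_right.1 (congrArg Subtype.val heq)).symm
      · intro hv
        exact absurd (Finset.mem_erase.2 ⟨hadj.ne', hs _ heM v (Sym2.mem_mk_right u v)⟩) hv
  rw [hsplit, Finset.sum_add_distrib, Finset.sum_comm, ← Finset.sum_filter, Finset.filter_filter,
    sum_matchingTerm_uncovered x b hu, sub_eq_add_neg, ← Finset.sum_neg_distrib]
  congr 1
  refine Finset.sum_congr rfl fun v hv => ?_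
  rw [← Finset.sum_filter, Finset.filter_filter]
  by_cases h : G.Adj u v
  · simp only [adjWeight, h, dif_pos, exists_true_left]
    exact sum_matchingTerm_mem x b hu hv h
  · simp [adjWeight, h]

/-- Quasi-homogeneity: each edge uses up two vertices, so edge weights have degree 2. -/
theorem inducedMatchingSum_scale (c : R) (x : V → R) (b : G.edgeSet → R) (S : Finset V) :
    inducedMatchingSum G (fun v => c * x v) (fun e => c ^ 2 * b e) S =
      c ^ S.card * inducedMatchingSum G x b S := by
  classical
  induction S using Finset.strongInduction with
  | H S ih =>
    rcases S.eq_empty_or_nonempty with rfl | ⟨u, hu⟩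
    · simp [inducedMatchingSum_empty]
    · have h1 := Finset.erase_ssubset hu
      rw [inducedMatchingSum_eq _ _ hu, inducedMatchingSum_eq x b hu, ih _ h1,
        ← Finset.card_erase_add_one hu, mul_sub, Finset.mul_sum]
      congr 1
      · ring
      · refine Finset.sum_congr rfl fun v hv => ?_
        rw [ih _ ((Finset.erase_ssubset hv).trans h1), ← Finset.card_erase_add_one hv,
          adjWeight_map b (fun r => c ^ 2 * r) (mul_zero _)]
        ring

theorem inducedMatchingSum_one_zero (S : Finset V) :
    inducedMatchingSum G (fun _ => (1 : R)) (fun _ => 0) S = 1 := by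
  classical
  induction S using Finset.strongInduction with
  | H S ih =>
    rcases S.eq_empty_or_nonempty with rfl | ⟨u, hu⟩
    · simp [inducedMatchingSum_empty]
    · rw [inducedMatchingSum_eq _ _ hu, ih _ (Finset.erase_ssubset hu)]
      simp [adjWeight]

end Recursion

/-! ### Homogeneity, stability and hyperbolicity -/

section Polynomial

variable {V : Type*} {G : SimpleGraph V} [Fintype G.edgeSet]

open MvPolynomial in
theorem inducedMatchingSum_isHomogeneous (S : Finset V) :
    (inducedMatchingSum G (fun v => (X (Sum.inl v) : MvPolynomial (V ⊕ G.edgeSet) ℝ))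
      (fun e => X (Sum.inr e) ^ 2) S).IsHomogeneous S.card := by
  classical
  induction S using Finset.strongInduction with
  | H S ih =>
    rcases S.eq_empty_or_nonempty with rfl | ⟨u, hu⟩
    · rw [inducedMatchingSum_empty]
      exact isHomogeneous_one _ _
    · have h1 := Finset.erase_ssubset hu
      rw [inducedMatchingSum_eq _ _ hu, ← Finset.card_erase_add_one hu]
      refine IsHomogeneous.sub ?_ (IsHomogeneous.sum _ _ _ fun v hv => ?_)
      · rw [add_comm]
        exact (isHomogeneous_X _ _).mul (ih _ h1)
      · rw [← Finset.card_erase_add_one hv,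
          show ∀ n, n + 1 + 1 = 2 + n from fun n => by omega]
        refine IsHomogeneous.mul ?_ (ih _ ((Finset.erase_ssubset hv).trans h1))
        unfold adjWeight
        split_ifs
        · simpa using (isHomogeneous_X ℝ _).pow 2
        · exact isHomogeneous_zero _ _ _

theorem matchingPolynomial_eq [Fintype V] : matchingPolynomial G =
    inducedMatchingSum G (fun v => (MvPolynomial.X (Sum.inl v) : MvPolynomial (V ⊕ G.edgeSet) ℝ))
      (fun e => MvPolynomial.X (Sum.inr e) ^ 2) Finset.univ := by
  unfold matchingPolynomial inducedMatchingSum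
  exact Finset.sum_congr (by ext M; simp) fun _ _ => rfl

theorem eval_matchingPolynomial [Fintype V] (z : V ⊕ G.edgeSet → ℝ) :
    MvPolynomial.eval z (matchingPolynomial G) =
      inducedMatchingSum G (fun v => z (Sum.inl v)) (fun e => z (Sum.inr e) ^ 2)
        Finset.univ := by
  rw [matchingPolynomial_eq, map_inducedMatchingSum]
  simp

theorem aeval_matchingPolynomial [Fintype V] (z : V ⊕ G.edgeSet → ℂ) :
    MvPolynomial.aeval z (matchingPolynomial G) =
      inducedMatchingSum G (fun v => z (Sum.inl v)) (fun e => z (Sum.inr e) ^ 2)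
        Finset.univ := by
  rw [matchingPolynomial_eq, ← AlgHom.coe_toRingHom, map_inducedMatchingSum]
  simp

/-- Heilmann–Lieb: dividing the recursion by m(S∖u) gives x_u minus nonnegative multiples of
inverses of smaller ratios, and inversion sends the upper half-plane to the lower one. -/
theorem inducedMatchingSum_stable {x : V → ℂ} (hx : ∀ v, 0 < (x v).im) {b : G.edgeSet → ℝ}
    (hb : ∀ e, 0 ≤ b e) (S : Finset V) :
    inducedMatchingSum G x (fun e => (b e : ℂ)) S ≠ 0 := by
  classical
  set m := inducedMatchingSum G x (fun e => (b e : ℂ)) with hm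
  have main : ∀ S : Finset V, m S ≠ 0 ∧ ∀ u ∈ S, 0 < (m S / m (S.erase u)).im := by
    intro S
    induction S using Finset.strongInduction with
    | H S ih =>
      have hpos : ∀ u ∈ S, 0 < (m S / m (S.erase u)).im := by
        intro u hu
        obtain ⟨h0, h1⟩ := ih _ (Finset.erase_ssubset hu)
        rw [hm, inducedMatchingSum_eq _ _ hu, ← hm, sub_div, mul_div_cancel_right₀ _ h0,
          Finset.sum_div, Complex.sub_im, Complex.im_sum]
        refine lt_of_lt_of_le (hx u) ?_
        rw [le_sub_self_iff]
        refine Finset.sum_nonpos fun v hv => ?_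
        have hq := h1 v hv
        rw [adjWeight_map b (fun r : ℝ => (r : ℂ)) Complex.ofReal_zero, mul_div_assoc,
          Complex.im_ofReal_mul, ← inv_div, Complex.inv_im]
        have hw : 0 ≤ adjWeight b u v := by
          unfold adjWeight
          split_ifs
          exacts [hb _, le_rfl]
        exact mul_nonpos_of_nonneg_of_nonpos hw
          (div_nonpos_of_nonpos_of_nonneg (by linarith) (Complex.normSq_nonneg _))
      refine ⟨?_, hpos⟩
      rcases S.eq_empty_or_nonempty with rfl | ⟨u, hu⟩
      · simp [hm, inducedMatchingSum_empty]
      · intro h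
        have := hpos u hu
        simp [h] at this
  exact (main S).1

theorem matchingPolynomial_isHyperbolic [Fintype V] :
    IsHyperbolic (matchingPolynomial G) (vertexOnes G) := by
  refine ⟨⟨_, matchingPolynomial_eq (G := G) ▸ inducedMatchingSum_isHomogeneous _⟩, ?_, ?_⟩
  · rw [eval_matchingPolynomial]
    simp [vertexOnes, inducedMatchingSum_one_zero]
  · intro x z hz
    have key : ∀ z : ℂ, 0 < z.im → inducedMatchingSum G (fun v => z - (x (Sum.inl v) : ℂ))
        (fun e => ((x (Sum.inr e) ^ 2 : ℝ) : ℂ)) Finset.univ ≠ 0 := fun z hz =>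
      inducedMatchingSum_stable (fun v => by simpa using hz) (fun e => sq_nonneg _) _
    rw [aeval_matchingPolynomial] at hz
    simp only [vertexOnes, Sum.elim_inl, Sum.elim_inr, Complex.ofReal_one, mul_one,
      Complex.ofReal_zero, mul_zero, zero_sub, neg_sq] at hz
    rcases lt_trichotomy z.im 0 with h | h | h
    · exfalso
      -- The coefficients are real, so a zero in the lower half-plane can be conjugated.
      refine key (starRingEnd ℂ z) (by simpa using h) ?_
      have := congrArg (starRingEnd ℂ) hz
      rw [map_inducedMatchingSum] at this
      simpa using this
    · exact h
    · exact absurd (by simpa using hz) (key z h)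

end Polynomial

/-! ### Positivity on the cone and its passage to induced subgraphs -/

section RealRoots

variable {V : Type*} {G : SimpleGraph V} [Fintype G.edgeSet]

theorem continuous_inducedMatchingSum {x : ℝ → V → ℝ} {b : ℝ → G.edgeSet → ℝ}
    (hx : ∀ v, Continuous fun s => x s v) (hb : ∀ e, Continuous fun s => b s e) (S : Finset V) :
    Continuous fun s => inducedMatchingSum G (x s) (b s) S := by
  unfold inducedMatchingSum
  fun_prop

theorem continuous_inducedMatchingSum_add (x : V → ℝ) (b : G.edgeSet → ℝ) (S : Finset V) :
    Continuous fun s => inducedMatchingSum G (fun v => x v + s) b S :=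
  continuous_inducedMatchingSum (fun _ => by fun_prop) (fun _ => by fun_prop) S

open Filter Topology in
theorem eventually_inducedMatchingSum_pos (x : V → ℝ) (b : G.edgeSet → ℝ) (S : Finset V) :
    ∀ᶠ s in atTop, 0 < inducedMatchingSum G (fun v => x v + s) b S := by
  -- Here r stands for 1/s: after dividing by s ^ |S|, the sum tends to its value 1 at unit vertex
  -- weights and zero edge weights.
  have hc : Continuous fun r : ℝ =>
      inducedMatchingSum G (fun v => 1 + r * x v) (fun e => r ^ 2 * b e) S :=
    continuous_inducedMatchingSum (fun _ => by fun_prop) (fun _ => by fun_prop) S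
  have ht := (hc.tendsto 0).comp tendsto_inv_atTop_zero
  simp only [zero_mul, add_zero, ne_eq, OfNat.ofNat_ne_zero, not_false_eq_true, zero_pow,
    inducedMatchingSum_one_zero] at ht
  filter_upwards [ht.eventually_const_lt one_pos, eventually_gt_atTop 0] with s hs hs0
  have := inducedMatchingSum_scale s (fun v => 1 + s⁻¹ * x v) (fun e => s⁻¹ ^ 2 * b e) S
  have hx : (fun v => s * (1 + s⁻¹ * x v)) = fun v => x v + s := by
    funext v
    field_simp
    ring
  have hb : (fun e => s ^ 2 * (s⁻¹ ^ 2 * b e)) = b := by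
    funext e
    field_simp
  rw [hx, hb] at this
  rw [this]
  exact mul_pos (pow_pos hs0 _) hs

theorem inducedMatchingSum_pos_of_ne_zero {x : V → ℝ} {b : G.edgeSet → ℝ} {S : Finset V} {a : ℝ}
    (h : ∀ s, a < s → inducedMatchingSum G (fun v => x v + s) b S ≠ 0) {s : ℝ} (hs : a < s) :
    0 < inducedMatchingSum G (fun v => x v + s) b S := by
  by_contra hneg
  obtain ⟨t, ht, hst⟩ := ((eventually_inducedMatchingSum_pos x b S).and
    (Filter.eventually_ge_atTop s)).exists
  obtain ⟨r, hr, hr0⟩ := intermediate_value_Icc hst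
    (continuous_inducedMatchingSum_add x b S).continuousOn ⟨not_lt.1 hneg, ht.le⟩
  exact h r (hs.trans_le hr.1) hr0

-- At a largest zero r > 0 of m(S∖u), induction gives m(S∖{u,v}) ≥ 0, so the recursion forces m(S) ≤
-- 0 there, a contradiction.
open Classical in
theorem inducedMatchingSum_erase_pos {b : G.edgeSet → ℝ} (hb : ∀ e, 0 ≤ b e) {S : Finset V}
    {x : V → ℝ} (h : ∀ s, 0 < s → 0 < inducedMatchingSum G (fun v => x v + s) b S) {u : V}
    (hu : u ∈ S) {s : ℝ} (hs : 0 < s) :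
    0 < inducedMatchingSum G (fun v => x v + s) b (S.erase u) := by
  induction S using Finset.strongInduction generalizing x u s with
  | H S ih =>
    set f : ℝ → ℝ := fun s => inducedMatchingSum G (fun v => x v + s) b (S.erase u) with hf
    have hfc : Continuous f := continuous_inducedMatchingSum_add x b _
    by_contra hneg
    obtain ⟨T, hT⟩ := Filter.eventually_atTop.1
      (eventually_inducedMatchingSum_pos x b (S.erase u))
    have hcomp : IsCompact {t | t ∈ Set.Icc s T ∧ f t ≤ 0} :=
      isCompact_Icc.inter_right (isClosed_le hfc continuous_const)
    have hbound : ∀ t, s ≤ t → f t ≤ 0 → t ∈ {t | t ∈ Set.Icc s T ∧ f t ≤ 0} := by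
      refine fun t hst ht => ⟨⟨hst, ?_⟩, ht⟩
      by_contra hc
      exact absurd (hT t (not_le.1 hc).le) (not_lt.2 ht)
    obtain ⟨r, ⟨⟨hsr, -⟩, hr0⟩, hr⟩ :=
      hcomp.exists_isGreatest ⟨s, hbound s le_rfl (not_lt.1 hneg)⟩
    have hfpos : ∀ t, r < t → 0 < f t := by
      intro t ht
      by_contra hc
      exact absurd (hr (hbound t (hsr.trans ht.le) (not_lt.1 hc))) (not_le.2 ht)
    have hlim : ∀ g : ℝ → ℝ, Continuous g → (∀ t, 0 < t → 0 < g (r + t)) → 0 ≤ g r := by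
      intro g hg hpos
      refine ge_of_tendsto (hg.continuousWithinAt (s := Set.Ioi r) (x := r)) ?_
      filter_upwards [self_mem_nhdsWithin] with t ht
      have := hpos (t - r) (sub_pos.2 ht)
      rw [add_sub_cancel] at this
      exact this.le
    have hfr : f r = 0 :=
      le_antisymm hr0 (hlim f hfc fun t ht => hfpos _ (lt_add_of_pos_right r ht))
    have hSr := h r (hs.trans_le hsr)
    rw [inducedMatchingSum_eq _ _ hu] at hSr
    change 0 < (x u + r) * f r - _ at hSr
    rw [hfr, mul_zero, zero_sub, neg_pos] at hSr
    refine absurd hSr (not_lt.2 (Finset.sum_nonneg fun v hv => mul_nonneg ?_ ?_))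
    · unfold adjWeight
      split_ifs
      exacts [hb _, le_rfl]
    · refine hlim _ (continuous_inducedMatchingSum_add x b _) fun t ht => ?_
      -- The induction hypothesis is used with base point x + r, since m(S∖u) is positive only
      -- beyond r.
      have := ih _ (Finset.erase_ssubset hu) (x := fun v => x v + r)
        (fun t ht => by simpa [hf, add_assoc] using hfpos _ (lt_add_of_pos_right r ht)) hv ht
      simpa [add_assoc] using this

theorem inducedMatchingSum_pos_of_univ [Fintype V] {x : V → ℝ} {b : G.edgeSet → ℝ}
    (hb : ∀ e, 0 ≤ b e)
    (h : ∀ s, 0 < s → inducedMatchingSum G (fun v => x v + s) b Finset.univ ≠ 0)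
    (S : Finset V) {s : ℝ} (hs : 0 < s) :
    0 < inducedMatchingSum G (fun v => x v + s) b S := by
  classical
  rw [← compl_compl S]
  induction Sᶜ using Finset.induction_on generalizing s with
  | empty =>
    rw [Finset.compl_empty]
    exact inducedMatchingSum_pos_of_ne_zero h hs
  | insert u T hu ih =>
    rw [Finset.compl_insert]
    exact inducedMatchingSum_erase_pos hb (fun s hs => ih hs) (Finset.mem_compl.2 hu) hs

theorem mem_hyperbolicityCone_matchingPolynomial [Fintype V] (z : V ⊕ G.edgeSet → ℝ) :
    z ∈ hyperbolicityCone (matchingPolynomial G) (vertexOnes G) ↔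
      ∀ s, 0 < s → inducedMatchingSum G (fun v => z (Sum.inl v) + s)
        (fun e => z (Sum.inr e) ^ 2) Finset.univ ≠ 0 := by
  have key : ∀ t : ℝ, MvPolynomial.eval (t • vertexOnes G - z) (matchingPolynomial G) = 0 ↔
      inducedMatchingSum G (fun v => z (Sum.inl v) + -t)
        (fun e => z (Sum.inr e) ^ 2) Finset.univ = 0 := by
    intro t
    -- Scaling by −1 turns t − x into x − t; the squared edge weights do not change.
    have := inducedMatchingSum_scale (-1) (fun v => z (Sum.inl v) + -t)
      (fun e => z (Sum.inr e) ^ 2) (Finset.univ : Finset V)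
    rw [eval_matchingPolynomial]
    simp only [vertexOnes, Pi.sub_apply, Pi.smul_apply, Sum.elim_inl, Sum.elim_inr, smul_eq_mul,
      mul_one, mul_zero, zero_sub, neg_sq]
    have hx : (fun v : V => -1 * (z (Sum.inl v) + -t)) = fun v => t - z (Sum.inl v) := by
      funext v
      ring
    have hb : (fun e : G.edgeSet => (-1) ^ 2 * z (Sum.inr e) ^ 2) =
        fun e => z (Sum.inr e) ^ 2 := by
      funext e
      ring
    rw [hx, hb] at this
    rw [this]
    simp
  constructor
  · intro h s hs h0
    have := h (-s) ((key _).2 (by simpa using h0))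
    linarith
  · intro h t ht
    by_contra hneg
    exact h (-t) (by linarith) ((key t).1 ht)

end RealRoots

/-! ### The forest pencil and its quadratic form -/

section PathPencil

/-- Nonempty lists of distinct vertices, thought of as the nodes of a forest in which the parent
of a list is its tail. -/
abbrev NodupPath (V : Type*) := {l : List V // l.Nodup ∧ l ≠ []}

open Classical in
noncomputable instance NodupPath.instFintype {V : Type*} [Fintype V] : Fintype (NodupPath V) :=
  Fintype.ofInjective (fun p => (⟨p.1, p.2.1⟩ : {l : List V // l.Nodup}))
    fun _ _ h => Subtype.ext (Subtype.mk.inj h)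

variable {V : Type*} {G : SimpleGraph V}

/-- The vertex coordinate of `z` at the head of a list. -/
def headWeight (z : V ⊕ G.edgeSet → ℝ) : List V → ℝ
  | [] => 0
  | v :: _ => z (Sum.inl v)

/-- The edge coordinate of `z` at the first two entries of a list, zero if there is no such
edge. -/
noncomputable def firstEdgeWeight (z : V ⊕ G.edgeSet → ℝ) : List V → ℝ
  | c :: d :: _ => adjWeight (fun e => z (Sum.inr e)) c d
  | _ => 0

open Classical in
/-- The linear matrix pencil of the weighted adjacency matrices of the forest of paths. -/
noncomputable def pathPencil (G : SimpleGraph V) :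
    (V ⊕ G.edgeSet → ℝ) →ₗ[ℝ] Matrix (NodupPath V) (NodupPath V) ℝ where
  -- The three cases exclude each other, since a tail is strictly shorter. Consecutive non-adjacent
  -- vertices get weight zero, so lists that are not paths in G are harmless.
  toFun z := Matrix.of fun p q => (if p = q then headWeight z p.1 else 0) +
    (if p.1.tail = q.1 then firstEdgeWeight z p.1 else 0) +
    (if q.1.tail = p.1 then firstEdgeWeight z q.1 else 0)
  map_add' y z := by
    have h1 : ∀ l, headWeight (y + z) l = headWeight y l + headWeight z l := by
      rintro (_ | ⟨v, l⟩) <;> simp [headWeight]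
    have h2 : ∀ l, firstEdgeWeight (y + z) l = firstEdgeWeight y l + firstEdgeWeight z l := by
      rintro (_ | ⟨c, _ | ⟨d, l⟩⟩) <;> simp only [firstEdgeWeight, adjWeight, add_zero]
      split_ifs <;> simp
    ext p q
    simp only [h1, h2, Matrix.of_apply, Matrix.add_apply]
    split_ifs <;> ring
  map_smul' c z := by
    have h1 : ∀ l, headWeight (c • z) l = c * headWeight z l := by
      rintro (_ | ⟨v, l⟩) <;> simp [headWeight]
    have h2 : ∀ l, firstEdgeWeight (c • z) l = c * firstEdgeWeight z l := by
      rintro (_ | ⟨c, _ | ⟨d, l⟩⟩) <;> simp only [firstEdgeWeight, adjWeight, mul_zero]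
      split_ifs <;> simp
    ext p q
    simp only [h1, h2, Matrix.of_apply, Matrix.smul_apply, RingHom.id_apply, smul_eq_mul]
    split_ifs <;> ring

open Classical in
theorem pathPencil_apply (z : V ⊕ G.edgeSet → ℝ) (p q : NodupPath V) :
    pathPencil G z p q = (if p = q then headWeight z p.1 else 0) +
      (if p.1.tail = q.1 then firstEdgeWeight z p.1 else 0) +
      (if q.1.tail = p.1 then firstEdgeWeight z q.1 else 0) := rfl

theorem pathPencil_isSymm (z : V ⊕ G.edgeSet → ℝ) : (pathPencil G z).IsSymm := by
  refine Matrix.IsSymm.ext fun p q => ?_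
  rw [pathPencil_apply, pathPencil_apply]
  by_cases h : p = q
  · subst h
    rfl
  · rw [if_neg h, if_neg (Ne.symm h)]
    ring

open Classical in
theorem pathPencil_vertexOnes : pathPencil G (vertexOnes G) = 1 := by
  have h2 : ∀ l, firstEdgeWeight (vertexOnes G) l = 0 := by
    rintro (_ | ⟨c, _ | ⟨d, l⟩⟩) <;> simp [firstEdgeWeight, adjWeight, vertexOnes]
  ext ⟨p, hp, hne⟩ q
  obtain ⟨v, l, rfl⟩ := List.exists_cons_of_ne_nil hne
  rw [pathPencil_apply, h2, h2, headWeight]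
  simp only [ite_self]
  simp [Matrix.one_apply, vertexOnes]

open Classical in
/-- The product of the negated edge weights along the part of a list that precedes its suffix
`p`, and zero for lists of which `p` is not a suffix. -/
noncomputable def suffixWeight (z : V ⊕ G.edgeSet → ℝ) (p : List V) : List V → ℝ
  | [] => 0
  | c :: q => if c :: q = p then 1 else - firstEdgeWeight z (c :: q) * suffixWeight z p q

theorem suffixWeight_eq_zero (z : V ⊕ G.edgeSet → ℝ) {p q : List V} (h : q.length < p.length) :
    suffixWeight z p q = 0 := by
  induction q with
  | nil => rfl
  | cons c q ih =>
    rw [suffixWeight, if_neg (by rintro rfl; exact lt_irrefl _ h),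
      ih (by simp only [List.length_cons] at h; omega), mul_zero]

variable [Fintype V]

open Classical in
/-- The vertices that are not on a list. -/
noncomputable def offPath (l : List V) : Finset V := {v | v ∉ l}

open Classical in
theorem offPath_cons (c : V) (l : List V) : offPath (c :: l) = (offPath l).erase c := by
  ext v
  simp [offPath]

theorem mem_offPath {c : V} {l : List V} : c ∈ offPath l ↔ c ∉ l := by
  simp [offPath]

open Classical in
theorem sum_ite_tail_eq (p : NodupPath V) {f : List V → ℝ} (hf : f [] = 0) :
    ∑ q : NodupPath V, (if p.1.tail = q.1 then f q.1 else 0) = f p.1.tail := by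
  by_cases h : p.1.tail = []
  · rw [h, hf]
    exact Finset.sum_eq_zero fun q _ => if_neg fun h' => q.2.2 h'.symm
  · rw [Finset.sum_eq_single ⟨p.1.tail, p.2.1.tail, h⟩]
    · simp
    · intro q _ hq
      exact if_neg fun h' => hq (Subtype.ext h'.symm)
    · simp

open Classical in
theorem sum_offPath_cons (p : NodupPath V) (F : List V → ℝ) :
    ∑ c ∈ offPath p.1, F (c :: p.1) =
      ∑ q : NodupPath V, if q.1.tail = p.1 then F q.1 else 0 := by
  rw [← Finset.sum_filter]
  refine Finset.sum_bij (fun c hc => ⟨c :: p.1, List.nodup_cons.2 ⟨mem_offPath.1 hc, p.2.1⟩,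
    List.cons_ne_nil _ _⟩) ?_ ?_ ?_ ?_
  · simp
  · intro c _ d _ h
    simpa using h
  · rintro ⟨q, hq, hne⟩ h
    obtain ⟨c, l, rfl⟩ := List.exists_cons_of_ne_nil hne
    obtain rfl : l = p.1 := by simpa using h
    exact ⟨c, mem_offPath.2 (List.nodup_cons.1 hq).1, rfl⟩
  · simp

/-- Groups the nodes by parent; the singletons are roots without a parent, so their terms have to
vanish. -/
theorem sum_sum_offPath_cons {F : List V → ℝ} (hF : ∀ v, F [v] = 0) :
    ∑ p : NodupPath V, ∑ c ∈ offPath p.1, F (c :: p.1) = ∑ p : NodupPath V, F p.1 := by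
  classical
  simp_rw [sum_offPath_cons]
  rw [Finset.sum_comm]
  refine Finset.sum_congr rfl fun q _ => ?_
  refine (Finset.sum_congr rfl fun p _ => ?_).trans
    ((sum_ite_tail_eq q (f := fun l => if l = [] then 0 else F q.1) (if_pos rfl)).trans ?_)
  · rw [if_neg p.2.2]
  · obtain ⟨q, hq, hne⟩ := q
    obtain ⟨c, l, rfl⟩ := List.exists_cons_of_ne_nil hne
    rcases l with _ | ⟨d, l⟩ <;> simp [hF]

-- Each forest edge is charged to its child, and occurs twice by symmetry. The value 0 at `[]`
-- removes the missing parents of the roots.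
open Matrix in
theorem dotProduct_pathPencil (z : V ⊕ G.edgeSet → ℝ) {Y : List V → ℝ} (hY : Y [] = 0) :
    (fun p : NodupPath V => Y p.1) ⬝ᵥ (pathPencil G z *ᵥ fun p => Y p.1) =
      ∑ p : NodupPath V, (headWeight z p.1 * Y p.1 ^ 2 +
        2 * (firstEdgeWeight z p.1 * Y p.1 * Y p.1.tail)) := by
  classical
  have key : ∀ p : NodupPath V,
      ∑ q : NodupPath V, (if p.1.tail = q.1 then firstEdgeWeight z p.1 * Y p.1 * Y q.1 else 0) =
        firstEdgeWeight z p.1 * Y p.1 * Y p.1.tail := fun p =>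
    sum_ite_tail_eq p (f := fun l => firstEdgeWeight z p.1 * Y p.1 * Y l) (by simp [hY])
  have h1 : ∑ p : NodupPath V, ∑ q : NodupPath V,
      (if p = q then headWeight z p.1 * Y p.1 * Y q.1 else 0) =
        ∑ p : NodupPath V, headWeight z p.1 * Y p.1 ^ 2 := by
    refine Finset.sum_congr rfl fun p _ => ?_
    rw [Finset.sum_ite_eq, if_pos (Finset.mem_univ _)]
    ring
  have h2 := Finset.sum_congr (rfl : (Finset.univ : Finset (NodupPath V)) = _) fun p _ => key p
  have h3 := h2
  rw [Finset.sum_comm] at h3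
  simp only [dotProduct, mulVec, Finset.mul_sum, pathPencil_apply]
  rw [Finset.sum_add_distrib, ← Finset.mul_sum, two_mul, ← h1]
  nth_rewrite 1 [← h2]
  rw [← h3, ← Finset.sum_add_distrib, ← Finset.sum_add_distrib]
  refine Finset.sum_congr rfl fun p _ => ?_
  rw [← Finset.sum_add_distrib, ← Finset.sum_add_distrib]
  refine Finset.sum_congr rfl fun q _ => ?_
  split_ifs <;> ring

variable [Fintype G.edgeSet]

theorem inducedMatchingSum_offPath (z : V ⊕ G.edgeSet → ℝ) {v : V} {l : List V} (hv : v ∉ l) :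
    inducedMatchingSum G (fun v => z (Sum.inl v)) (fun e => z (Sum.inr e) ^ 2) (offPath l) =
      headWeight z (v :: l) * inducedMatchingSum G (fun v => z (Sum.inl v))
        (fun e => z (Sum.inr e) ^ 2) (offPath (v :: l)) -
      ∑ c ∈ offPath (v :: l), firstEdgeWeight z (c :: v :: l) ^ 2 *
        inducedMatchingSum G (fun v => z (Sum.inl v)) (fun e => z (Sum.inr e) ^ 2)
          (offPath (c :: v :: l)) := by
  classical
  rw [inducedMatchingSum_eq _ _ (mem_offPath.2 hv), ← offPath_cons]
  congr 1
  refine Finset.sum_congr rfl fun c _ => ?_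
  rw [offPath_cons c, firstEdgeWeight,
    adjWeight_map (fun e => z (Sum.inr e)) (fun r : ℝ => r ^ 2) (by simp), adjWeight_comm]

-- The recursion says that each diagonal entry is r(p) + ∑ w²/r over the children of p. Completing
-- the square at each node leaves w²/r times the square at its parent, which these sums absorb.
open Matrix in
theorem dotProduct_pathPencil_nonneg {z : V ⊕ G.edgeSet → ℝ}
    (hm : ∀ S, 0 < inducedMatchingSum G (fun v => z (Sum.inl v)) (fun e => z (Sum.inr e) ^ 2) S)
    (y : NodupPath V → ℝ) : 0 ≤ y ⬝ᵥ (pathPencil G z *ᵥ y) := by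
  classical
  set m := inducedMatchingSum G (fun v => z (Sum.inl v)) (fun e => z (Sum.inr e) ^ 2) with hmdef
  set Y : List V → ℝ := fun l => if h : l.Nodup ∧ l ≠ [] then y ⟨l, h⟩ else 0 with hYdef
  have hY0 : Y [] = 0 := by simp [hYdef]
  have hyY : y = fun p => Y p.1 := by
    funext p
    simp only [hYdef, dif_pos p.2]
  set r : List V → ℝ := fun l => m (offPath l.tail) / m (offPath l) with hr
  have hrpos : ∀ l, 0 < r l := fun l => div_pos (hm _) (hm _)
  have hrec : ∀ p : NodupPath V, headWeight z p.1 =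
      r p.1 + ∑ c ∈ offPath p.1, firstEdgeWeight z (c :: p.1) ^ 2 / r (c :: p.1) := by
    rintro ⟨p, hp, hne⟩
    obtain ⟨v, l, rfl⟩ := List.exists_cons_of_ne_nil hne
    have h0 : m (offPath (v :: l)) ≠ 0 := (hm _).ne'
    simp only [hr, List.tail_cons]
    rw [hmdef, inducedMatchingSum_offPath z (List.nodup_cons.1 hp).1, ← hmdef, sub_div,
      mul_div_cancel_right₀ _ h0, Finset.sum_div]
    simp only [div_div_eq_mul_div, sub_add_cancel]
  have hchild := sum_sum_offPath_cons
    (F := fun l => firstEdgeWeight z l ^ 2 / r l * Y l.tail ^ 2) (by simp [hY0])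
  rw [hyY, dotProduct_pathPencil z hY0]
  have : ∑ p : NodupPath V, (headWeight z p.1 * Y p.1 ^ 2 +
        2 * (firstEdgeWeight z p.1 * Y p.1 * Y p.1.tail)) =
      ∑ p : NodupPath V, r p.1 * (Y p.1 + firstEdgeWeight z p.1 / r p.1 * Y p.1.tail) ^ 2 := by
    have h1 : ∀ p : NodupPath V, r p.1 * (Y p.1 + firstEdgeWeight z p.1 / r p.1 * Y p.1.tail) ^ 2 =
        (r p.1 * Y p.1 ^ 2 + 2 * (firstEdgeWeight z p.1 * Y p.1 * Y p.1.tail)) +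
          firstEdgeWeight z p.1 ^ 2 / r p.1 * Y p.1.tail ^ 2 := by
      intro p
      have := (hrpos p.1).ne'
      field_simp
      ring
    simp_rw [h1]
    conv_rhs => rw [Finset.sum_add_distrib, ← hchild, ← Finset.sum_add_distrib]
    refine Finset.sum_congr rfl fun p _ => ?_
    rw [hrec p]
    simp only [List.tail_cons]
    rw [← Finset.sum_mul]
    ring
  rw [this]
  exact Finset.sum_nonneg fun p _ => mul_nonneg (hrpos _).le (sq_nonneg _)

-- For a minimal S with m(S) = 0, a vector supported on the subtree above `u :: l`, where l lists
-- the complement of S, is annihilated by every row in its support, yet takes the nonzero value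
-- m(S∖u) at `u :: l`.
open Matrix in
theorem inducedMatchingSum_ne_zero_of_pathPencil {z : V ⊕ G.edgeSet → ℝ}
    (hpos : ∀ y : NodupPath V → ℝ, y ≠ 0 → 0 < y ⬝ᵥ (pathPencil G z *ᵥ y)) (S : Finset V) :
    inducedMatchingSum G (fun v => z (Sum.inl v)) (fun e => z (Sum.inr e) ^ 2) S ≠ 0 := by
  classical
  set m := inducedMatchingSum G (fun v => z (Sum.inl v)) (fun e => z (Sum.inr e) ^ 2) with hmdef
  induction S using Finset.strongInduction with
  | H S ih =>
    rcases S.eq_empty_or_nonempty with rfl | ⟨u, hu⟩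
    · simp [hmdef, inducedMatchingSum_empty]
    intro hS
    set l := (Sᶜ).toList with hl
    have hul : u ∉ l := by simp [hl, hu]
    have hoff : offPath l = S := by
      ext v
      simp [offPath, hl]
    set W := suffixWeight z (u :: l) with hW
    -- The factor W propagates away from `u :: l` so that the children's terms match the recursion.
    set Y : List V → ℝ := fun q => W q * m (offPath q) with hYdef
    have hW1 : W (u :: l) = 1 := by rw [hW, suffixWeight, if_pos rfl]
    have hY0 : Y [] = 0 := by simp [hYdef, hW, suffixWeight]
    have hquad := dotProduct_pathPencil z hY0
    have hchild := sum_sum_offPath_cons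
      (F := fun l => firstEdgeWeight z l * Y l * Y l.tail) (by simp [hY0])
    have hlocal : ∀ p : NodupPath V, Y p.1 * (headWeight z p.1 * Y p.1 +
        firstEdgeWeight z p.1 * Y p.1.tail +
        ∑ c ∈ offPath p.1, firstEdgeWeight z (c :: p.1) * Y (c :: p.1)) = 0 := by
      rintro ⟨p, hp, hne⟩
      obtain ⟨v, q, rfl⟩ := List.exists_cons_of_ne_nil hne
      have hrec := inducedMatchingSum_offPath z (List.nodup_cons.1 hp).1
      rw [← hmdef] at hrec
      simp only [List.tail_cons]
      by_cases hWp : W (v :: q) = 0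
      · simp [hYdef, hWp]
      have hlen : (u :: l).length ≤ (v :: q).length := by
        by_contra hc
        exact hWp (suffixWeight_eq_zero z (not_le.1 hc))
      have hWc : ∀ c, W (c :: v :: q) = - firstEdgeWeight z (c :: v :: q) * W (v :: q) := by
        intro c
        rw [hW, suffixWeight, if_neg]
        intro heq
        have := congrArg List.length heq
        simp only [List.length_cons] at this hlen
        omega
      have hsum : headWeight z (v :: q) * Y (v :: q) +
          ∑ c ∈ offPath (v :: q), firstEdgeWeight z (c :: v :: q) * Y (c :: v :: q) =
          W (v :: q) * m (offPath q) := by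
        rw [hrec, mul_sub, Finset.mul_sum, sub_eq_add_neg, ← Finset.sum_neg_distrib]
        congr 1
        · simp only [hYdef]
          ring
        · refine Finset.sum_congr rfl fun c _ => ?_
          simp only [hYdef, hWc]
          ring
      have htail : firstEdgeWeight z (v :: q) * Y q + W (v :: q) * m (offPath q) = 0 := by
        -- At the bottom of the subtree the parent contributes nothing, and m(S) = 0 is what closes
        -- the row.
        by_cases heq : v :: q = u :: l
        · have hWq : W q = 0 := suffixWeight_eq_zero z (by simp [← heq])
          rw [show Y q = W q * m (offPath q) from rfl, hWq, (List.cons_eq_cons.1 heq).2, hoff, hS]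
          simp
        · have : W (v :: q) = - firstEdgeWeight z (v :: q) * W q := by
            rw [hW, suffixWeight, if_neg heq]
          rw [this]
          simp only [hYdef]
          ring
      rw [add_right_comm, hsum, add_comm, htail, mul_zero]
    refine absurd (hpos (fun p => Y p.1) ?_) ?_
    · intro h0
      have hnd : (u :: l).Nodup := List.nodup_cons.2 ⟨hul, Finset.nodup_toList _⟩
      have h1 : Y (u :: l) = 0 := congrFun h0 ⟨u :: l, hnd, List.cons_ne_nil _ _⟩
      simp only [hYdef, hW1, one_mul, offPath_cons, hoff] at h1
      exact ih _ (Finset.erase_ssubset hu) h1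
    · rw [hquad, not_lt]
      refine le_of_eq (Eq.trans ?_
        (Finset.sum_eq_zero (s := Finset.univ) fun p _ => hlocal p))
      simp only [two_mul, ← add_assoc]
      rw [Finset.sum_add_distrib, ← hchild, ← Finset.sum_add_distrib]
      refine Finset.sum_congr rfl fun p _ => ?_
      simp only [List.tail_cons]
      rw [← Finset.sum_mul]
      ring

open Matrix in
theorem mem_hyperbolicityCone_iff_pathPencil (z : V ⊕ G.edgeSet → ℝ) :
    z ∈ hyperbolicityCone (matchingPolynomial G) (vertexOnes G) ↔
      (pathPencil G z).PosSemidef := by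
  classical
  have hshift : ∀ (s : ℝ) (y : NodupPath V → ℝ),
      y ⬝ᵥ (pathPencil G (z + s • vertexOnes G) *ᵥ y) =
        y ⬝ᵥ (pathPencil G z *ᵥ y) + s * (y ⬝ᵥ y) := by
    intro s y
    rw [map_add, map_smul, pathPencil_vertexOnes, add_mulVec, dotProduct_add, smul_mulVec,
      one_mulVec, dotProduct_smul, smul_eq_mul]
  have hinl : ∀ s : ℝ, (fun v => (z + s • vertexOnes G) (Sum.inl v)) =
      fun v => z (Sum.inl v) + s := fun s => by simp [vertexOnes]
  have hinr : ∀ s : ℝ, (fun e => (z + s • vertexOnes G) (Sum.inr e) ^ 2) =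
      fun e => z (Sum.inr e) ^ 2 := fun s => by simp [vertexOnes]
  rw [mem_hyperbolicityCone_matchingPolynomial]
  constructor
  · intro h
    refine PosSemidef.of_dotProduct_mulVec_nonneg ?_ fun y => ?_
    · rw [IsHermitian, conjTranspose_eq_transpose_of_trivial]
      exact pathPencil_isSymm z
    · rw [star_trivial]
      have hs : ∀ s : ℝ, 0 < s → 0 ≤ y ⬝ᵥ (pathPencil G z *ᵥ y) + s * (y ⬝ᵥ y) := by
        intro s hs
        rw [← hshift]
        refine dotProduct_pathPencil_nonneg (fun S => ?_) y
        rw [hinl, hinr]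
        exact inducedMatchingSum_pos_of_univ (fun e => sq_nonneg _) h S hs
      -- Letting s decrease to 0 gives semidefiniteness at z itself.
      have hc : Continuous fun s : ℝ => y ⬝ᵥ (pathPencil G z *ᵥ y) + s * (y ⬝ᵥ y) := by fun_prop
      have := ge_of_tendsto (hc.continuousWithinAt (s := Set.Ioi 0) (x := 0))
        (Filter.eventually_of_mem self_mem_nhdsWithin fun s h => hs s h)
      simpa using this
  · intro h s hs
    rw [← hinl, ← hinr s]
    refine inducedMatchingSum_ne_zero_of_pathPencil (fun y hy => ?_) _
    rw [hshift]
    have h1 := h.dotProduct_mulVec_nonneg y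
    rw [star_trivial] at h1
    have h2 : 0 < y ⬝ᵥ y := by
      simpa using dotProduct_star_self_pos_iff.2 hy
    have := mul_pos hs h2
    linarith

end PathPencil

/-! ### From a linear pencil to a spectrahedral cone -/

theorem isSpectrahedral_of_linearMap {ι n : Type*} [Fintype ι] [Fintype n] {K : Set (ι → ℝ)}
    (A : (ι → ℝ) →ₗ[ℝ] Matrix n n ℝ) (hA : ∀ x, (A x).IsSymm) (hpos : ∃ y, (A y).PosDef)
    (hK : ∀ x, x ∈ K ↔ (A x).PosSemidef) : IsSpectrahedral K := by
  classical
  let f := (Fintype.equivFin n).symm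
  have hsum : ∀ x : ι → ℝ, ∑ i, x i • (A (Pi.single i 1)).submatrix f f =
      (A x).submatrix f f := by
    intro x
    conv_rhs => rw [pi_eq_sum_univ' x, map_sum]
    ext p q
    simp [Matrix.sum_apply]
  refine ⟨Fintype.card n, fun i => (A (Pi.single i 1)).submatrix f f,
    fun i => (hA _).submatrix f, ?_, ?_⟩
  · obtain ⟨y, hy⟩ := hpos
    exact ⟨y, by rw [hsum]; exact hy.submatrix f.injective⟩
  · ext x
    rw [hK, Set.mem_ofPred_eq, hsum, Matrix.posSemidef_submatrix_equiv]

theorem theorem2p13 {V : Type*} [Fintype V] (G : SimpleGraph V) [Fintype G.edgeSet] :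
    IsHyperbolic (matchingPolynomial G) (vertexOnes G) ∧
      IsSpectrahedral (hyperbolicityCone (matchingPolynomial G) (vertexOnes G)) := by
  classical
  exact ⟨matchingPolynomial_isHyperbolic, isSpectrahedral_of_linearMap (pathPencil G)
    pathPencil_isSymm ⟨vertexOnes G, by rw [pathPencil_vertexOnes]; exact Matrix.PosDef.one⟩
    mem_hyperbolicityCone_iff_pathPencil⟩
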